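/- There exists a surjectively universal Polish group. That is, there is a Polish group $G$ (a topological group whose underlying space is separable and completely metrizable) such that every Polish group $H$ is isomorphic, as a topological group, to a topological quotient group $G/N$ of $G$ for some normal subgroup $N$ of $G$. In particular, for every Polish group $H$ there is a continuous surjective homomorphism $\Phi: G\to H$. -/

import Mathlib

universe u v

/-- A Polish group `G` is surjectively universal if every Polish group `H` is isomorphic, as a
topological group, to a topological quotient group `G ⧸ N` of `G` (with the quotient topology). -/
def IsSurjectivelyUniversal (G : Type u) [Group G] [TopologicalSpace G] [IsTopologicalGroup G]
    [PolishSpace G] : Prop :=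
  ∀ (H : Type v) [Group H] [TopologicalSpace H] [IsTopologicalGroup H] [PolishSpace H],
    ∃ (N : Subgroup G) (_ : N.Normal), Nonempty ((G ⧸ N) ≃ₜ* H)

open Filter Topology Uniformity UniformSpace

/-! The universal group is the two-sided completion of the free group `CodeGroup` on finite
sequences of naturals, whose countable neighborhood basis `SmallWord` makes the generators along any
infinite branch Cauchy. Given a Polish `H` with a dense sequence `d`, a finite sequence codes
successive approximations by points of `d`, moves that are too large being ignored. So, whatever `H`
is, `decode` carries `SmallWord n` into `U n` (`decode_mem`); it is continuous and extends to the
completion because `H` is complete (`completeSpace_of_polishSpace`). Every point near a coded point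
is the limit of a decoded branch (`exists_branch`). Branches converge in the completion and stay
close to their start, so the extension is open; its range is an open, hence closed, dense subgroup,
which is all of `H`. -/

/-- A topological group endowed with its two-sided uniformity, the supremum of
the left and the right uniformities. -/
class IsTwoSidedUniformGroup (G : Type*) [UniformSpace G] [Group G] : Prop
    extends IsTopologicalGroup G where
  uniformity_eq : 𝓤 G = comap (fun x : G × G ↦ x.2 * x.1⁻¹) (𝓝 1) ⊓
    comap (fun x : G × G ↦ x.1⁻¹ * x.2) (𝓝 1)

/-- The two-sided uniformity of a topological group. -/
abbrev twoSidedUniformSpace (G : Type*) [Group G] [t : TopologicalSpace G] [IsTopologicalGroup G] :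
    UniformSpace G :=
  (IsTopologicalGroup.rightUniformSpace G ⊓ IsTopologicalGroup.leftUniformSpace G).replaceTopology
    (by rw [UniformSpace.toTopologicalSpace_inf]; exact (inf_idem t).symm)

theorem isTwoSidedUniformGroup_twoSidedUniformSpace (G : Type*) [Group G] [TopologicalSpace G]
    [IsTopologicalGroup G] : @IsTwoSidedUniformGroup G (twoSidedUniformSpace G) _ :=
  letI := twoSidedUniformSpace G
  { toIsTopologicalGroup := ‹_›
    uniformity_eq := rfl }

/-! ### Group structure on the two-sided completion. -/

namespace IsTwoSidedUniformGroup

section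

variable {G : Type*} [Group G] [UniformSpace G] [IsTwoSidedUniformGroup G]

theorem tendsto_uniformity_iff {ι : Type*} {l : Filter ι} {f : ι → G × G} :
    Tendsto f l (𝓤 G) ↔ Tendsto (fun i ↦ (f i).2 * (f i).1⁻¹) l (𝓝 1) ∧
      Tendsto (fun i ↦ (f i).1⁻¹ * (f i).2) l (𝓝 1) := by
  rw [uniformity_eq, tendsto_inf, tendsto_comap_iff, tendsto_comap_iff]
  rfl

instance isCountablyGenerated_uniformity [FirstCountableTopology G] :
    (𝓤 G).IsCountablyGenerated := by
  rw [uniformity_eq]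
  infer_instance

theorem uniformContinuous_monoidHom {H : Type*} [Group H] [UniformSpace H]
    [IsTwoSidedUniformGroup H] (f : G →* H) (hf : Continuous f) : UniformContinuous f := by
  have h1 : Tendsto f (𝓝 1) (𝓝 1) := by simpa using hf.tendsto 1
  obtain ⟨hr, hl⟩ := tendsto_uniformity_iff.1 (tendsto_id (x := 𝓤 G))
  refine tendsto_uniformity_iff.2 ⟨?_, ?_⟩
  · simpa [Function.comp_def] using h1.comp hr
  · simpa [Function.comp_def] using h1.comp hl

theorem uniformContinuous_inv : UniformContinuous (fun x : G ↦ x⁻¹) := by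
  obtain ⟨hr, hl⟩ := tendsto_uniformity_iff.1 (tendsto_id (x := 𝓤 G))
  refine tendsto_uniformity_iff.2 ⟨?_, ?_⟩
  · simpa using hl.inv
  · simpa using hr.inv

/-- For a fixed `s` far along `A`, `b f a⁻¹ = (b s⁻¹)(s f s⁻¹)(s a⁻¹)`: the outer factors are small
by the Cauchy condition, the middle one by continuity of a single conjugation. -/
theorem tendsto_conj_of_cauchy {A : Filter G} [NeBot A]
    (hA : Tendsto (fun p : G × G ↦ p.2 * p.1⁻¹) (A ×ˢ A) (𝓝 1)) {ι : Type*} {l : Filter ι}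
    {a b f : ι → G} (ha : Tendsto a l A) (hb : Tendsto b l A) (hf : Tendsto f l (𝓝 1)) :
    Tendsto (fun i ↦ b i * f i * (a i)⁻¹) l (𝓝 1) := by
  intro U hU
  have hc : Tendsto (fun p : G × G × G ↦ p.1 * p.2.1 * p.2.2) (𝓝 1 ×ˢ 𝓝 1 ×ˢ 𝓝 1) (𝓝 1) := by
    rw [← nhds_prod_eq, ← nhds_prod_eq]
    exact Continuous.tendsto' (by fun_prop) _ _ (by simp)
  obtain ⟨V, hV, W, hW, hVW⟩ := mem_prod_iff.1 (hc hU)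
  obtain ⟨W₁, hW₁, W₂, hW₂, hWW⟩ := mem_prod_iff.1 hW
  obtain ⟨S, hS, hSS⟩ := mem_prod_self_iff.1 (hA (inter_mem hV hW₂))
  obtain ⟨s, hs⟩ := nonempty_of_mem hS
  have hfs : Tendsto (fun i ↦ s * f i * s⁻¹) l (𝓝 1) := by
    simpa using (hf.const_mul s).mul_const s⁻¹
  rw [mem_map]
  filter_upwards [ha.eventually_mem hS, hb.eventually_mem hS, hfs.eventually_mem hW₁] with i hai hbi hfi
  have h1 : b i * s⁻¹ ∈ V := (hSS (Set.mk_mem_prod hs hbi)).1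
  have h2 : s * (a i)⁻¹ ∈ W₂ := (hSS (Set.mk_mem_prod hai hs)).2
  have := hVW (Set.mk_mem_prod h1 (hWW (Set.mk_mem_prod hfi h2)))
  simpa [mul_assoc] using this

theorem cauchy_map_mul {A B : Filter G} (hA : Cauchy A) (hB : Cauchy B) :
    Cauchy (map (fun p : G × G ↦ p.1 * p.2) (A ×ˢ B)) := by
  have := hA.1
  have := hB.1
  obtain ⟨hAr, hAl⟩ := tendsto_uniformity_iff.1 (show Tendsto id (A ×ˢ A) (𝓤 G) from hA.2)
  obtain ⟨hBr, hBl⟩ := tendsto_uniformity_iff.1 (show Tendsto id (B ×ˢ B) (𝓤 G) from hB.2)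
  rw [cauchy_map_iff', tendsto_uniformity_iff]
  have a₁ : Tendsto (fun p : (G × G) × G × G ↦ p.1.1) ((A ×ˢ B) ×ˢ A ×ˢ B) A :=
    tendsto_fst.comp tendsto_fst
  have a₂ : Tendsto (fun p : (G × G) × G × G ↦ p.2.1) ((A ×ˢ B) ×ˢ A ×ˢ B) A :=
    tendsto_fst.comp tendsto_snd
  have b₁ : Tendsto (fun p : (G × G) × G × G ↦ p.1.2) ((A ×ˢ B) ×ˢ A ×ˢ B) B :=
    tendsto_snd.comp tendsto_fst
  have b₂ : Tendsto (fun p : (G × G) × G × G ↦ p.2.2) ((A ×ˢ B) ×ˢ A ×ˢ B) B :=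
    tendsto_snd.comp tendsto_snd
  constructor
  · have := tendsto_conj_of_cauchy hAr a₁ a₂ (hBr.comp (b₁.prodMk b₂))
    simpa [mul_assoc] using this
  -- Inversion exchanges left and right, so `b₁⁻¹ (a₁⁻¹ a₂) b₂` falls under the same lemma.
  · have hB' : Tendsto (fun p : G × G ↦ p.2 * p.1⁻¹) (map Inv.inv B ×ˢ map Inv.inv B) (𝓝 1) := by
      rw [prod_map_map_eq, tendsto_map'_iff]
      simpa [Function.comp_def] using hBl.comp (tendsto_snd.prodMk tendsto_fst)
    have := tendsto_conj_of_cauchy hB' (tendsto_map.comp b₂) (tendsto_map.comp b₁)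
      (hAl.comp (a₁.prodMk a₂))
    simpa [mul_assoc] using this

end

theorem isDenseInducing_coe_prodMap (X : Type*) [UniformSpace X] :
    IsDenseInducing (Prod.map ((↑) : X → Completion X) ((↑) : X → Completion X)) :=
  Completion.isDenseInducing_coe.prodMap Completion.isDenseInducing_coe

section Completion

variable (G : Type*) [Group G] [UniformSpace G] [IsTwoSidedUniformGroup G]

instance completionOne : One (Completion G) := ⟨((1 : G) : Completion G)⟩

noncomputable instance completionInv : Inv (Completion G) := ⟨Completion.map (fun x : G ↦ x⁻¹)⟩

/-- Multiplication need not be uniformly continuous; the extension is continuous because of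
`cauchy_map_mul`. -/
noncomputable instance completionMul : Mul (Completion G) :=
  ⟨fun x y ↦ (isDenseInducing_coe_prodMap G).extend
    (fun p : G × G ↦ ((p.1 * p.2 : G) : Completion G)) (x, y)⟩

variable {G}

theorem coe_inv (x : G) : ((x⁻¹ : G) : Completion G) = (x : Completion G)⁻¹ :=
  (Completion.map_coe uniformContinuous_inv x).symm

theorem coe_mul (x y : G) : ((x * y : G) : Completion G) = (x : Completion G) * y :=
  ((isDenseInducing_coe_prodMap G).extend_eq
    (f := fun p : G × G ↦ ((p.1 * p.2 : G) : Completion G))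
    ((Completion.continuous_coe G).comp continuous_mul) (x, y)).symm

instance completionContinuousInv : ContinuousInv (Completion G) := ⟨Completion.continuous_map⟩

instance completionContinuousMul : ContinuousMul (Completion G) := by
  refine ⟨(isDenseInducing_coe_prodMap G).continuous_extend fun ⟨x, y⟩ ↦ ?_⟩
  have hc : ∀ z : Completion G, Cauchy (comap ((↑) : G → Completion G) (𝓝 z)) := fun z ↦
    cauchy_nhds.comap' (Completion.comap_coe_eq_uniformity G).le
      (Completion.isDenseInducing_coe.comap_nhds_neBot z)
  have := ((cauchy_map_mul (hc x) (hc y)).map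
    (Completion.uniformContinuous_coe G))
  obtain ⟨z, hz⟩ := CompleteSpace.complete this
  refine ⟨z, ?_⟩
  rw [nhds_prod_eq, show Prod.map ((↑) : G → Completion G) ((↑) : G → Completion G) =
    fun p ↦ ((p.1 : Completion G), (p.2 : Completion G)) from rfl, ← prod_comap_comap_eq]
  rwa [map_map] at hz

noncomputable instance completionGroup : Group (Completion G) :=
  Group.ofLeftAxioms
    (fun x y z ↦ Completion.induction_on₃ x y z (isClosed_eq (by fun_prop) (by fun_prop))
      fun a b c ↦ by simp only [← coe_mul, mul_assoc])
    (fun x ↦ Completion.induction_on x (isClosed_eq (by fun_prop) (by fun_prop))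
      fun a ↦ by
        change ((1 : G) : Completion G) * a = a
        rw [← coe_mul, one_mul])
    (fun x ↦ Completion.induction_on x (isClosed_eq (by fun_prop) (by fun_prop))
      fun a ↦ by
        rw [← coe_inv, ← coe_mul, inv_mul_cancel]
        rfl)

instance completionIsTopologicalGroup : IsTopologicalGroup (Completion G) where

instance completionIsCountablyGenerated [(𝓤 G).IsCountablyGenerated] :
    (𝓤 (Completion G)).IsCountablyGenerated := by
  let := UniformSpace.pseudoMetricSpace G
  infer_instance

instance completionPolishSpace [FirstCountableTopology G] [TopologicalSpace.SeparableSpace G] :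
    PolishSpace (Completion G) := by
  have : SecondCountableTopology (Completion G) := UniformSpace.secondCountable_of_separable _
  infer_instance

end Completion

end IsTwoSidedUniformGroup

/-! ### Completeness of Polish groups by Baire category. -/

/-- A completely metrizable space is comeagre in every Hausdorff space containing it densely. -/
theorem IsDenseInducing.range_mem_residual {X Y : Type*} [TopologicalSpace X]
    [TopologicalSpace.IsCompletelyMetrizableSpace X] [TopologicalSpace Y] [T2Space Y] {i : X → Y}
    (hi : IsDenseInducing i) : Set.range i ∈ residual Y := by
  let := TopologicalSpace.upgradeIsCompletelyMetrizable X
  let O : ℕ → Set Y := fun n ↦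
    ⋃₀ {V | IsOpen V ∧ ∀ a b, i a ∈ V → i b ∈ V → dist a b < 1 / ((n : ℝ) + 1)}
  have hO : ∀ n, IsOpen (O n) := fun n ↦ isOpen_sUnion fun V hV ↦ hV.1
  have hd : ∀ n, Dense (O n) := fun n ↦ hi.dense.mono <| by
    rintro _ ⟨x, rfl⟩
    have hn : 0 < 1 / ((n : ℝ) + 1) / 2 := by positivity
    obtain ⟨V, hV, hVx⟩ := hi.isInducing.isOpen_iff.1 (Metric.isOpen_ball (x := x)
      (ε := 1 / ((n : ℝ) + 1) / 2))
    refine ⟨V, ⟨hV, fun a b ha hb ↦ ?_⟩, ?_⟩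
    · have ha' : a ∈ Metric.ball x (1 / ((n : ℝ) + 1) / 2) := hVx ▸ ha
      have hb' : b ∈ Metric.ball x (1 / ((n : ℝ) + 1) / 2) := hVx ▸ hb
      have := dist_triangle_right a b x
      rw [Metric.mem_ball] at ha' hb'
      linarith
    · change x ∈ i ⁻¹' V
      rw [hVx]
      exact Metric.mem_ball_self hn
  -- A point of every `O n` has a Cauchy trace on `X`, whose limit must map to that point.
  refine mem_of_superset (countable_iInter_mem.2 fun n ↦ residual_of_dense_open (hO n) (hd n)) ?_
  intro y hy
  rw [Set.mem_iInter] at hy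
  have := hi.comap_nhds_neBot y
  have hc : Cauchy (comap i (𝓝 y)) := by
    refine Metric.cauchy_iff.2 ⟨this, fun ε hε ↦ ?_⟩
    obtain ⟨n, hn⟩ := exists_nat_one_div_lt hε
    obtain ⟨V, ⟨hV, hdist⟩, hyV⟩ := hy n
    exact ⟨i ⁻¹' V, preimage_mem_comap (hV.mem_nhds hyV),
      fun a ha b hb ↦ (hdist a b ha hb).trans hn⟩
  obtain ⟨x, hx⟩ := CompleteSpace.complete hc
  refine ⟨x, tendsto_nhds_unique (f := i) (l := comap i (𝓝 y)) ?_ tendsto_comap⟩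
  exact (hi.continuous.tendsto x).mono_left hx

/-- Polish groups are complete in their two-sided uniformity. -/
theorem IsTwoSidedUniformGroup.completeSpace_of_polishSpace {H : Type*} [Group H] [UniformSpace H]
    [IsTwoSidedUniformGroup H] [PolishSpace H] : CompleteSpace H := by
  have hsurj : Function.Surjective ((↑) : H → Completion H) := by
    intro g
    have h1 := (Completion.isDenseInducing_coe (α := H)).range_mem_residual
    have h2 : IsDenseInducing fun x : H ↦ g * (x : Completion H) :=
      ⟨(Homeomorph.mulLeft g).isInducing.comp Completion.isDenseInducing_coe.isInducing,
        (Homeomorph.mulLeft g).surjective.denseRange.comp Completion.denseRange_coe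
          (Homeomorph.mulLeft g).continuous⟩
    have h3 := h2.range_mem_residual
    -- The comeagre sets `H` and `g H` meet, so `a = g b`.
    obtain ⟨_, ⟨a, rfl⟩, ⟨b, hb⟩⟩ := (dense_of_mem_residual (inter_mem h1 h3)).nonempty
    refine ⟨a * b⁻¹, ?_⟩
    rw [coe_mul, coe_inv, ← hb, mul_inv_cancel_right]
  exact ((Completion.isUniformInducing_coe H).completeSpace_congr hsurj).2 inferInstance

/-! ### The coding group and its topology. -/

/-- The free group on finite sequences of natural numbers. It is topologized below. -/
def CodeGroup : Type := FreeGroup (List ℕ)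

namespace CodeGroup

instance : Group CodeGroup := inferInstanceAs (Group (FreeGroup (List ℕ)))

instance : Countable CodeGroup :=
  inferInstanceAs (Countable (Quot (FreeGroup.Red.Step (α := List ℕ))))

/-- The generator attached to a finite sequence. -/
def gen (s : List ℕ) : CodeGroup := FreeGroup.of s

theorem gen_induction {p : CodeGroup → Prop} (x : CodeGroup) (one : p 1)
    (of : ∀ s, p (gen s)) (inv_of : ∀ s, p (gen s)⁻¹) (mul : ∀ x y, p x → p y → p (x * y)) : p x :=
  FreeGroup.induction_on x one of (fun s _ ↦ inv_of s) mul

/-- The homomorphism from the free group prescribed on generators. -/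
def lift {H : Type*} [Group H] (f : List ℕ → H) : CodeGroup →* H := FreeGroup.lift f

theorem lift_gen {H : Type*} [Group H] (f : List ℕ → H) (s : List ℕ) : lift f (gen s) = f s :=
  FreeGroup.lift_apply_of

end CodeGroup

open CodeGroup in
/-- The smallest family of subsets of `CodeGroup`, indexed by `ℕ`, which
makes the elements `s` and `k :: s` close to each other and generates a group topology. -/
inductive SmallWord : ℕ → CodeGroup → Prop
  | one (n : ℕ) : SmallWord n 1
  | left (s : List ℕ) (k : ℕ) :
      SmallWord s.length ((gen s)⁻¹ * gen (k :: s))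
  | right (s : List ℕ) (k : ℕ) :
      SmallWord s.length (gen (k :: s) * (gen s)⁻¹)
  | inv {n : ℕ} {a : CodeGroup} : SmallWord n a → SmallWord n a⁻¹
  | mul {n : ℕ} {a b : CodeGroup} :
      SmallWord (n + 1) a → SmallWord (n + 1) b → SmallWord n (a * b)
  -- In any `H`, `s.sum` bounds the index coded by `s` (`index_le`), so the level `s.sum + n + 1`
  -- controls this conjugation.
  | conj (s : List ℕ) {n : ℕ} {a : CodeGroup} : SmallWord (s.sum + n + 1) a →
      SmallWord n (gen s * a * (gen s)⁻¹)
  | conjInv (s : List ℕ) {n : ℕ} {a : CodeGroup} : SmallWord (s.sum + n + 1) a →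
      SmallWord n ((gen s)⁻¹ * a * gen s)

namespace SmallWord

theorem anti {m n : ℕ} (h : m ≤ n) {a : CodeGroup} (ha : SmallWord n a) :
    SmallWord m a := by
  induction h using Nat.decreasingInduction with
  | self => exact ha
  | of_succ k _ ih => simpa using ih.mul (one (k + 1))

theorem exists_conj (x : CodeGroup) :
    ∀ n, ∃ m, ∀ a, SmallWord m a → SmallWord n (x * a * x⁻¹) := by
  induction x using CodeGroup.gen_induction with
  | one => exact fun n ↦ ⟨n, fun a ha ↦ by simpa using ha⟩
  | of s => exact fun n ↦ ⟨s.sum + n + 1, fun a ha ↦ ha.conj s⟩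
  | inv_of s => exact fun n ↦ ⟨s.sum + n + 1, fun a ha ↦ by simpa using ha.conjInv s⟩
  | mul x y hx hy =>
    intro n
    obtain ⟨m, hm⟩ := hx n
    obtain ⟨l, hl⟩ := hy m
    exact ⟨l, fun a ha ↦ by simpa [mul_assoc] using hm _ (hl a ha)⟩

/-- The sets of small words form a basis of neighborhoods of the identity of a group topology. -/
abbrev groupFilterBasis : GroupFilterBasis CodeGroup where
  sets := Set.range fun n ↦ {a | SmallWord n a}
  nonempty := Set.range_nonempty _
  inter_sets := by
    rintro _ _ ⟨m, rfl⟩ ⟨n, rfl⟩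
    exact ⟨_, ⟨max m n, rfl⟩, fun a ha ↦
      ⟨anti (le_max_left m n) ha, anti (le_max_right m n) ha⟩⟩
  one' := by
    rintro _ ⟨n, rfl⟩
    exact one n
  mul' := by
    rintro _ ⟨n, rfl⟩
    refine ⟨_, ⟨n + 1, rfl⟩, ?_⟩
    rintro _ ⟨a, ha, b, hb, rfl⟩
    exact mul ha hb
  inv' := by
    rintro _ ⟨n, rfl⟩
    exact ⟨_, ⟨n, rfl⟩, fun a ha ↦ inv ha⟩
  conj' := by
    rintro x _ ⟨n, rfl⟩
    obtain ⟨m, hm⟩ := exists_conj x n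
    exact ⟨_, ⟨m, rfl⟩, hm⟩

end SmallWord

namespace CodeGroup

instance : TopologicalSpace CodeGroup := SmallWord.groupFilterBasis.topology

instance : IsTopologicalGroup CodeGroup := SmallWord.groupFilterBasis.isTopologicalGroup

instance : UniformSpace CodeGroup := twoSidedUniformSpace CodeGroup

instance : IsTwoSidedUniformGroup CodeGroup := isTwoSidedUniformGroup_twoSidedUniformSpace CodeGroup

theorem hasBasis_nhds_one :
    (𝓝 (1 : CodeGroup)).HasBasis (fun _ : ℕ ↦ True) fun n ↦ {a | SmallWord n a} :=
  SmallWord.groupFilterBasis.nhds_one_hasBasis.to_hasBasis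
    (by rintro _ ⟨n, rfl⟩; exact ⟨n, trivial, subset_rfl⟩)
    (fun n _ ↦ ⟨_, ⟨n, rfl⟩, subset_rfl⟩)

instance : FirstCountableTopology CodeGroup := by
  have h1 : (𝓝 (1 : CodeGroup)).IsCountablyGenerated := hasBasis_nhds_one.isCountablyGenerated
  refine ⟨fun x ↦ ?_⟩
  rw [← map_mul_left_nhds_one x]
  infer_instance

variable {x : ℕ → List ℕ} {k : ℕ → ℕ} {n : ℕ}

theorem length_branch (hx : ∀ m, x (m + 1) = k m :: x m) (h0 : (x 0).length = n) (m : ℕ) :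
    (x m).length = n + m := by
  induction m with
  | zero => simpa using h0
  | succ m ih => rw [hx, List.length_cons, ih, add_assoc]

/-- The increments telescope. Each product costs one level, and the initial length `n + 1` rather
than `n` pays for it. -/
theorem smallWord_branch_left (hx : ∀ m, x (m + 1) = k m :: x m) (h0 : (x 0).length = n + 1)
    (p : ℕ) : ∀ m, SmallWord (n + m) ((gen (x m))⁻¹ * gen (x (m + p))) := by
  induction p with
  | zero => intro m; simpa using SmallWord.one (n + m)
  | succ p ih =>
    intro m
    have h1 : SmallWord (n + m + 1) ((gen (x m))⁻¹ * gen (x (m + 1))) := by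
      have := SmallWord.left (x m) (k m)
      rw [← hx, length_branch hx h0] at this
      exact this.anti (by omega)
    have := h1.mul (ih (m + 1))
    rw [show m + 1 + p = m + (p + 1) by omega] at this
    simpa [mul_assoc] using this

theorem smallWord_branch_right (hx : ∀ m, x (m + 1) = k m :: x m) (h0 : (x 0).length = n + 1)
    (p : ℕ) : ∀ m, SmallWord (n + m) (gen (x (m + p)) * (gen (x m))⁻¹) := by
  induction p with
  | zero => intro m; simpa using SmallWord.one (n + m)
  | succ p ih =>
    intro m
    have h1 : SmallWord (n + m + 1) (gen (x (m + 1)) * (gen (x m))⁻¹) := by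
      have := SmallWord.right (x m) (k m)
      rw [← hx, length_branch hx h0] at this
      exact this.anti (by omega)
    have := SmallWord.mul (ih (m + 1)) h1
    rw [show m + 1 + p = m + (p + 1) by omega] at this
    simpa [mul_assoc] using this

theorem cauchySeq_branch (hx : ∀ m, x (m + 1) = k m :: x m) (h0 : (x 0).length = n + 1) :
    CauchySeq fun m ↦ gen (x m) := by
  rw [cauchySeq_iff_tendsto, IsTwoSidedUniformGroup.tendsto_uniformity_iff]
  constructor <;>
  · refine hasBasis_nhds_one.tendsto_right_iff.2 fun N _ ↦ ?_
    filter_upwards [eventually_ge_atTop (N + 1, N + 1)] with ⟨a, b⟩ hab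
    obtain ⟨i, rfl⟩ := Nat.exists_eq_add_of_le (show N + 1 ≤ a from hab.1)
    obtain ⟨j, rfl⟩ := Nat.exists_eq_add_of_le (show N + 1 ≤ b from hab.2)
    first
    | have := SmallWord.mul
        ((smallWord_branch_right hx h0 j (N + 1)).anti (by omega : N + 1 ≤ _))
        ((smallWord_branch_right hx h0 i (N + 1)).inv.anti (by omega : N + 1 ≤ _))
      simpa [mul_assoc] using this
    | have := SmallWord.mul
        ((smallWord_branch_left hx h0 i (N + 1)).inv.anti (by omega : N + 1 ≤ _))
        ((smallWord_branch_left hx h0 j (N + 1)).anti (by omega : N + 1 ≤ _))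
      simpa [mul_assoc] using this

end CodeGroup

/-! ### Decoding into a Polish group. -/

/-- A decreasing basis of neighborhoods of the identity, adapted to the group operations and to
the conjugations by the elements of a given sequence. -/
structure AdaptedBasis {H : Type*} [Group H] [TopologicalSpace H] (d : ℕ → H) (U : ℕ → Set H) :
    Prop where
  zero : U 0 = Set.univ
  hasBasis : (𝓝 (1 : H)).HasBasis (fun _ : ℕ ↦ True) U
  inv_mem : ∀ n, ∀ a ∈ U n, a⁻¹ ∈ U n
  mul_mem : ∀ n, ∀ a ∈ U (n + 1), ∀ b ∈ U (n + 1), a * b ∈ U n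
  conj_mem : ∀ n, ∀ j ≤ n, ∀ a ∈ U (n + 1), d j * a * (d j)⁻¹ ∈ U n
  conj_inv_mem : ∀ n, ∀ j ≤ n, ∀ a ∈ U (n + 1), (d j)⁻¹ * a * d j ∈ U n

theorem exists_adaptedBasis {H : Type*} [Group H] [TopologicalSpace H] [IsTopologicalGroup H]
    [FirstCountableTopology H] (d : ℕ → H) : ∃ U : ℕ → Set H, AdaptedBasis d U := by
  obtain ⟨B, hB⟩ := (𝓝 (1 : H)).exists_antitone_basis
  have step : ∀ (n : ℕ) (U : {U : Set H // U ∈ 𝓝 1}), ∃ W : {W : Set H // W ∈ 𝓝 1},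
      W.1 ⊆ B n ∧ (∀ a ∈ W.1, a⁻¹ ∈ W.1) ∧ (∀ a ∈ W.1, ∀ b ∈ W.1, a * b ∈ U.1) ∧
      (∀ j ≤ n, ∀ a ∈ W.1, d j * a * (d j)⁻¹ ∈ U.1) ∧
      ∀ j ≤ n, ∀ a ∈ W.1, (d j)⁻¹ * a * d j ∈ U.1 := by
    rintro n ⟨U, hU⟩
    obtain ⟨V, hV, hVU⟩ := exists_nhds_one_split hU
    have h1 : ∀ᶠ a in 𝓝 (1 : H), ∀ j ∈ Finset.Iic n, d j * a * (d j)⁻¹ ∈ U := by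
      rw [Finset.eventually_all]
      exact fun j _ ↦ (Continuous.tendsto' (by fun_prop) _ _ (by simp)).eventually_mem hU
    have h2 : ∀ᶠ a in 𝓝 (1 : H), ∀ j ∈ Finset.Iic n, (d j)⁻¹ * a * d j ∈ U := by
      rw [Finset.eventually_all]
      exact fun j _ ↦ (Continuous.tendsto' (by fun_prop) _ _ (by simp)).eventually_mem hU
    have h0 : ∀ᶠ a in 𝓝 (1 : H), a ∈ B n := hB.mem n
    have hV' : ∀ᶠ a in 𝓝 (1 : H), a ∈ V := hV
    have h3 := h0.and (hV'.and (h1.and h2))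
    have h4 := (tendsto_inv (1 : H)).eventually (by rwa [inv_one] : ∀ᶠ a in 𝓝 (1 : H)⁻¹, _)
    refine ⟨⟨_, h3.and h4⟩, fun a ha ↦ ha.1.1, fun a ha ↦ ⟨ha.2, ?_⟩,
      fun a ha b hb ↦ hVU a ha.1.2.1 b hb.1.2.1,
      fun j hj a ha ↦ ha.1.2.2.1 j (Finset.mem_Iic.2 hj),
      fun j hj a ha ↦ ha.1.2.2.2 j (Finset.mem_Iic.2 hj)⟩
    rw [inv_inv]
    exact ha.1
  choose f hfB hfi hfm hfc hfc' using step
  let U : ℕ → {U : Set H // U ∈ 𝓝 1} := fun n ↦ Nat.rec ⟨Set.univ, univ_mem⟩ f n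
  refine ⟨fun n ↦ (U n).1, rfl, ?_, ?_, fun n ↦ hfm n (U n), fun n ↦ hfc n (U n),
    fun n ↦ hfc' n (U n)⟩
  · exact hB.toHasBasis.to_hasBasis (fun n _ ↦ ⟨n + 1, trivial, hfB n (U n)⟩)
      fun n _ ↦ by simpa using hB.mem_iff.1 (U n).2
  · rintro (_ | n)
    · exact fun a _ ↦ Set.mem_univ _
    · exact hfi n (U n)

namespace AdaptedBasis

variable {H : Type*} [Group H] {d : ℕ → H} {U : ℕ → Set H}

open Classical in
/-- The index of the point coded by a finite sequence: each new entry replaces the current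
index provided that the point moves only a little. -/
noncomputable def index (d : ℕ → H) (U : ℕ → Set H) : List ℕ → ℕ
  | [] => 0
  | k :: s =>
    if (d (index d U s))⁻¹ * d k ∈ U s.length ∧ d k * (d (index d U s))⁻¹ ∈ U s.length then k
    else index d U s

theorem index_le (s : List ℕ) : index d U s ≤ s.sum := by
  induction s with
  | nil => simp [index]
  | cons k s ih =>
    rw [index, List.sum_cons]
    split_ifs <;> omega

theorem index_cons {k : ℕ} {s : List ℕ} (h1 : (d (index d U s))⁻¹ * d k ∈ U s.length)
    (h2 : d k * (d (index d U s))⁻¹ ∈ U s.length) : index d U (k :: s) = k := by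
  rw [index, if_pos ⟨h1, h2⟩]

/-- The homomorphism sending each finite sequence to the point it codes. -/
noncomputable def decode (d : ℕ → H) (U : ℕ → Set H) : CodeGroup →* H :=
  CodeGroup.lift fun s ↦ d (index d U s)

theorem decode_gen (s : List ℕ) : decode d U (CodeGroup.gen s) = d (index d U s) :=
  CodeGroup.lift_gen _ s

variable [TopologicalSpace H] (hU : AdaptedBasis d U)
include hU

theorem one_mem (n : ℕ) : 1 ∈ U n := mem_of_mem_nhds (hU.hasBasis.mem_of_mem trivial)

theorem anti : Antitone U :=
  antitone_nat_of_succ_le fun n a ha ↦ by simpa using hU.mul_mem n a ha 1 (hU.one_mem _)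

/-- Each constructor of `SmallWord` is matched by a property of `U`; a rejected move decodes to `1`.
-/
theorem decode_mem {n : ℕ} {a : CodeGroup} (ha : SmallWord n a) : decode d U a ∈ U n := by
  induction ha with
  | one n => simpa using hU.one_mem n
  | left s k =>
    rw [map_mul, map_inv, decode_gen, decode_gen, index]
    split_ifs with h
    · exact h.1
    · simpa using hU.one_mem _
  | right s k =>
    rw [map_mul, map_inv, decode_gen, decode_gen, index]
    split_ifs with h
    · exact h.2
    · simpa using hU.one_mem _
  | inv _ ih => simpa using hU.inv_mem _ _ ih
  | mul _ _ iha ihb => simpa using hU.mul_mem _ _ iha _ ihb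
  | conj s _ ih =>
    rw [map_mul, map_mul, map_inv, decode_gen]
    exact hU.anti (Nat.le_add_left _ _)
      (hU.conj_mem _ _ ((index_le s).trans (Nat.le_add_right _ _)) _ ih)
  | conjInv s _ ih =>
    rw [map_mul, map_mul, map_inv, decode_gen]
    exact hU.anti (Nat.le_add_left _ _)
      (hU.conj_inv_mem _ _ ((index_le s).trans (Nat.le_add_right _ _)) _ ih)

/-- A first move is never rejected, which puts all of `d` in the range. -/
theorem index_singleton (k : ℕ) : index d U [k] = k :=
  index_cons (by simp [hU.zero]) (by simp [hU.zero])

variable [IsTopologicalGroup H]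

theorem continuous_decode : Continuous (decode d U) := by
  refine continuous_of_continuousAt_one _ ?_
  rw [ContinuousAt, map_one]
  exact (CodeGroup.hasBasis_nhds_one.tendsto_iff hU.hasBasis).2
    fun n _ ↦ ⟨n, trivial, fun a ha ↦ hU.decode_mem ha⟩

/-- The old and new points are both `U (n + 1)`-close to `h`, so the move lies in `U n` and is
accepted. -/
theorem exists_index_cons (hd : DenseRange d) (h : H) {s : List ℕ} {n : ℕ} (hs : s.length = n)
    (h1 : (d (index d U s))⁻¹ * h ∈ U (n + 1)) (h2 : h * (d (index d U s))⁻¹ ∈ U (n + 1)) :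
    ∃ k, (d (index d U (k :: s)))⁻¹ * h ∈ U (n + 2) ∧
      h * (d (index d U (k :: s)))⁻¹ ∈ U (n + 2) := by
  have hn : U (n + 2) ∈ 𝓝 (1 : H) := hU.hasBasis.mem_of_mem trivial
  have e1 : ∀ᶠ x in 𝓝 h, x⁻¹ * h ∈ U (n + 2) :=
    (Continuous.tendsto' (by fun_prop) _ _ (by simp)).eventually_mem hn
  have e2 : ∀ᶠ x in 𝓝 h, h * x⁻¹ ∈ U (n + 2) :=
    (Continuous.tendsto' (by fun_prop) _ _ (by simp)).eventually_mem hn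
  obtain ⟨_, ⟨k, rfl⟩, hk1, hk2⟩ := hd.inter_nhds_nonempty (e1.and e2)
  refine ⟨k, ?_⟩
  subst hs
  rw [index_cons]
  · exact ⟨hk1, hk2⟩
  · have := hU.mul_mem _ _ h1 _ (hU.anti (Nat.le_succ _) (hU.inv_mem _ _ hk1))
    simpa [mul_assoc] using this
  · have := hU.mul_mem _ _ (hU.anti (Nat.le_succ _) (hU.inv_mem _ _ hk2)) _ h2
    simpa [mul_assoc] using this

theorem exists_branch (hd : DenseRange d) (h : H) {s : List ℕ} {n : ℕ} (hs : s.length = n)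
    (h1 : (d (index d U s))⁻¹ * h ∈ U (n + 1)) (h2 : h * (d (index d U s))⁻¹ ∈ U (n + 1)) :
    ∃ (x : ℕ → List ℕ) (k : ℕ → ℕ), x 0 = s ∧ (∀ m, x (m + 1) = k m :: x m) ∧
      Tendsto (fun m ↦ d (index d U (x m))) atTop (𝓝 h) := by
  let P : List ℕ → Prop := fun t ↦ (d (index d U t))⁻¹ * h ∈ U (t.length + 1) ∧
    h * (d (index d U t))⁻¹ ∈ U (t.length + 1)
  have step : ∀ t : {t // P t}, ∃ k, P (k :: t.1) := fun t ↦
    hU.exists_index_cons hd h rfl t.2.1 t.2.2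
  choose f hf using step
  subst hs
  let x : ℕ → {t // P t} := fun m ↦
    Nat.rec ⟨s, h1, h2⟩ (fun _ t ↦ ⟨f t :: t.1, hf t⟩) m
  have hx : ∀ m, (x (m + 1)).1 = f (x m) :: (x m).1 := fun m ↦ rfl
  refine ⟨fun m ↦ (x m).1, fun m ↦ f (x m), rfl, hx, ?_⟩
  have ht : Tendsto (fun m ↦ (d (index d U (x m).1))⁻¹ * h) atTop (𝓝 1) := by
    refine hU.hasBasis.tendsto_right_iff.2 fun N _ ↦ ?_
    filter_upwards [eventually_ge_atTop N] with m hm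
    refine hU.anti ?_ (x m).2.1
    have := CodeGroup.length_branch (x := fun m ↦ (x m).1) hx rfl m
    omega
  simpa using ht.inv.const_mul h

end AdaptedBasis

/-! ### The open surjection and the quotient. -/

open IsTwoSidedUniformGroup AdaptedBasis in
theorem exists_isOpenMap_surjective_completion_codeGroup (H : Type*) [Group H] [TopologicalSpace H]
    [IsTopologicalGroup H] [PolishSpace H] :
    ∃ f : Completion CodeGroup →* H, Continuous f ∧ IsOpenMap f ∧ Function.Surjective f := by
  let := twoSidedUniformSpace H
  have := isTwoSidedUniformGroup_twoSidedUniformSpace H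
  have : CompleteSpace H := completeSpace_of_polishSpace
  obtain ⟨d, hd⟩ := TopologicalSpace.exists_dense_seq H
  obtain ⟨U, hU⟩ := exists_adaptedBasis d
  have hφ : UniformContinuous (decode d U) := uniformContinuous_monoidHom _ hU.continuous_decode
  have hcont := Completion.continuous_extension (f := decode d U)
  have hcoe := Completion.extension_coe hφ
  let f : Completion CodeGroup →* H := MonoidHom.mk' (Completion.extension (decode d U)) <|
    fun a b ↦ Completion.induction_on₂ a b (isClosed_eq (by fun_prop) (by fun_prop))
      fun x y ↦ by rw [← coe_mul, hcoe, hcoe, hcoe, map_mul]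
  have hf : Continuous f := hcont
  have hfgen : ∀ s, f (CodeGroup.gen s : Completion CodeGroup) = d (index d U s) := fun s ↦
    (hcoe _).trans (decode_gen s)
  have hopen : IsOpenMap f := by
    rw [IsTopologicalGroup.isOpenMap_iff_nhds_one]
    -- Closed neighborhoods retain limits of small words.
    refine (closed_nhds_basis (1 : Completion CodeGroup)).map f |>.ge_iff.2 ?_
    rintro O ⟨hO, hOc⟩
    obtain ⟨n, -, hn⟩ := CodeGroup.hasBasis_nhds_one.mem_iff.1
      ((Completion.continuous_coe CodeGroup).continuousAt.preimage_mem_nhds hO)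
    -- Only the length of `s` matters: a branch starting there moves by `SmallWord n`.
    set s : List ℕ := List.replicate (n + 1) 0 with hs
    have hlen : s.length = n + 1 := List.length_replicate
    set c := d (index d U s) with hc
    have hn2 : U (n + 2) ∈ 𝓝 (1 : H) := hU.hasBasis.mem_of_mem trivial
    have e2 : ∀ᶠ x in 𝓝 (1 : H), c * x * c⁻¹ ∈ U (n + 2) :=
      (Continuous.tendsto' (by fun_prop) _ _ (by simp)).eventually_mem hn2
    filter_upwards [hn2, e2] with y hy1 hy2
    obtain ⟨x, k, hx0, hx, hlim⟩ := hU.exists_branch hd (c * y) hlen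
      (by simpa [← hc] using hy1) (by simpa [← hc] using hy2)
    have hx0' : (x 0).length = n + 1 := by rw [hx0, hlen]
    obtain ⟨g, hg⟩ := cauchySeq_tendsto_of_complete
      ((Completion.uniformContinuous_coe CodeGroup).comp_cauchySeq
        (CodeGroup.cauchySeq_branch hx hx0'))
    have hfg : f g = c * y := by
      refine tendsto_nhds_unique ((hf.tendsto g).comp hg) ?_
      simpa [Function.comp_def, hfgen] using hlim
    refine ⟨(CodeGroup.gen s : Completion CodeGroup)⁻¹ * g, ?_, ?_⟩
    · refine hOc.mem_of_tendsto (hg.const_mul _) (Eventually.of_forall fun m ↦ ?_)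
      have := CodeGroup.smallWord_branch_left hx hx0' m 0
      rw [hx0, zero_add, add_zero] at this
      have := hn this
      rwa [Set.mem_preimage, coe_mul, coe_inv] at this
    · rw [map_mul, map_inv, hfgen, hfg, inv_mul_cancel_left]
  refine ⟨f, hf, hopen, ?_⟩
  have hro : IsOpen (f.range : Set H) := by
    rw [MonoidHom.coe_range]
    exact hopen.isOpen_range
  have hrd : Dense (f.range : Set H) := hd.mono <| by
    rintro _ ⟨k, rfl⟩
    exact ⟨(CodeGroup.gen [k] : Completion CodeGroup), by rw [hfgen, hU.index_singleton]⟩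
  have := (f.range.isClosed_of_isOpen hro).closure_eq.symm.trans hrd.closure_eq
  rwa [MonoidHom.coe_range, Set.range_eq_univ] at this

theorem mainTheorem2 :
    ∃ (G : Type) (_ : Group G) (_ : TopologicalSpace G) (_ : IsTopologicalGroup G)
      (_ : PolishSpace G), IsSurjectivelyUniversal.{0, v} G := by
  refine ⟨Completion CodeGroup, inferInstance, inferInstance, inferInstance, inferInstance, ?_⟩
  intro H _ _ _ _
  obtain ⟨f, hf, hopen, hsurj⟩ := exists_isOpenMap_surjective_completion_codeGroup H
  refine ⟨f.ker, inferInstance,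
    ⟨(QuotientGroup.quotientKerEquivOfSurjective f hsurj).toContinuousMulEquiv fun s ↦ ?_⟩⟩
  rw [← (QuotientGroup.isQuotientMap_mk f.ker).isOpen_preimage]
  exact (IsOpenQuotientMap.mk hsurj hf hopen).isQuotientMap.isOpen_preimage
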